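/- Let $\underline X=(X_1\xleftarrow{p_1}X_2\xleftarrow{p_2}X_3\leftarrow\cdots)$ be an inverse sequence of sets. It is Mittag-Leffler if for every $n_0$ there is $n_1>n_0$ such that for all $n>n_1$ the images of $X_n$ and of $X_{n_1}$ in $X_{n_0}$ under the composed bonding maps coincide. Let $(T_{\underline X},v)$ be its rooted tree: the geometric realization, with the path metric in which every edge has length $1$, of the graph whose vertices are an extra root $v$ and the elements of the disjoint union of the $X_n$, and whose edges are $\{v,x\}$ for $x\in X_1$ and $\{p_n(x),x\}$ for $x\in X_{n+1}$, $n\ge 1$. A rooted real tree $(T,v)$ is geodesically complete if every isometric embedding $f:[0,t]\to T$, $t>0$, with $f(0)=v$ extends to an isometric embedding $[0,\infty)\to T$. Let $T_\infty\subset T_{\underline X}$ be the greatest geodesically complete subtree containing $v$. A continuous map $f:(T,v)\to(T',w)$ is rooted if $f(v)=w$, and metrically proper if preimages of bounded sets are bounded. A rooted metrically proper homotopy between such maps is a homotopy $H:T\times[0,1]\to T'$ with $H(v,t)=w$ for all $t$ such that for every $M>0$ there is $N>0$ with $H^{-1}(B(w,M))\subset B(v,N)\times[0,1]$. A rooted metrically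 proper homotopy equivalence is a rooted metrically proper continuous map that has an inverse of the same kind up to rooted metrically proper homotopy. **Proposition.** $\underline X$ is Mittag-Leffler if and only if there is a rooted metrically proper homotopy equivalence between $(T_{\underline X},v)$ and $(T_\infty,v)$. Moreover, in this case the equivalence can be chosen to be a deformation retraction: there is a map $r:T_{\underline X}\to T_\infty$ which, together with the inclusion $i:T_\infty\to T_{\underline X}$, forms a rooted metrically proper homotopy equivalence, and there is a rooted metrically proper homotopy $H$ from $\mathrm{id}_{T_{\underline X}}$ to $i\circ r$ with $H(x,t)=x$ for all $x\in T_\infty$ and $t\in[0,1]$. -/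

import Mathlib

open scoped NNReal unitInterval
open CategoryTheory Opposite Set

/-! ### Real trees, rooted subtrees, geodesic completeness -/

/-- `A` is an arc from `x` to `y`: the image of an injective path from `x` to `y`. -/
def IsArc {T : Type*} [TopologicalSpace T] (x y : T) (A : Set T) : Prop :=
  ∃ γ : Path x y, Function.Injective γ ∧ range γ = A

/-- Real trees: two distinct points are joined by a unique arc, and this arc is isometric to
a compact interval of length the distance of the points. -/
structure IsRealTree (T : Type*) [MetricSpace T] : Prop where
  existsUnique_arc : ∀ x y : T, x ≠ y → ∃! A : Set T, IsArc x y A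
  isometric_arc : ∀ (x y : T) (A : Set T), IsArc x y A →
    Nonempty (A ≃ᵢ Icc (0 : ℝ) (dist x y))

/-- `(T, v)` is geodesically complete: every isometric embedding `[0, t] → T`, `t > 0`, which
starts at `v` extends to an isometric embedding `[0, ∞) → T`. -/
def IsGeodesicallyComplete {T : Type*} [MetricSpace T] (v : T) : Prop :=
  ∀ t : ℝ, ∀ ht : 0 < t, ∀ f : Icc (0 : ℝ) t → T, Isometry f → f ⟨0, le_rfl, ht.le⟩ = v →
    ∃ g : Ici (0 : ℝ) → T, Isometry g ∧ ∀ s : Icc (0 : ℝ) t, g ⟨s, s.2.1⟩ = f s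

/-- `S` is a geodesically complete subtree of `(T, v)`: it contains the root `v`, it is a real tree
for the induced metric, and `(S, v)` is geodesically complete. -/
def IsGeodesicallyCompleteSubtree {T : Type*} [MetricSpace T] (v : T) (S : Set T) : Prop :=
  ∃ hv : v ∈ S, IsRealTree S ∧ IsGeodesicallyComplete (⟨v, hv⟩ : S)

/-- `T_∞`: the union of all geodesically complete subtrees of `(T, v)`. -/
def maximalGCSubtree {T : Type*} [MetricSpace T] (v : T) : Set T :=
  ⋃₀ {S | IsGeodesicallyCompleteSubtree v S}

/-! ### Rooted metrically proper maps, homotopies and homotopy equivalences -/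

/-- The continuous map `f` is rooted, `f v = w`, and metrically proper: preimages of bounded sets
are bounded. -/
def IsRootedMetricallyProper {T T' : Type*} [MetricSpace T] [MetricSpace T'] (v : T) (w : T')
    (f : C(T, T')) : Prop :=
  f v = w ∧ ∀ A : Set T', Bornology.IsBounded A → Bornology.IsBounded (f ⁻¹' A)

/-- The homotopy `H` is rooted and metrically proper. (In Mathlib the time comes first.) -/
def IsRootedMetricallyProperHomotopy {T T' : Type*} [MetricSpace T] [MetricSpace T'] (v : T)
    (w : T') {f g : C(T, T')} (H : f.Homotopy g) : Prop :=
  (∀ t : I, H (t, v) = w) ∧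
    ∀ M : ℝ, 0 < M → ∃ N : ℝ, 0 < N ∧ H ⁻¹' Metric.ball w M ⊆ univ ×ˢ Metric.ball v N

/-- `f` and `g` form a rooted metrically proper homotopy equivalence between `(T, v)` and
`(T', w)`. -/
def IsRootedMetricallyProperHomotopyEquiv {T T' : Type*} [MetricSpace T] [MetricSpace T'] (v : T)
    (w : T') (f : C(T, T')) (g : C(T', T)) : Prop :=
  IsRootedMetricallyProper v w f ∧ IsRootedMetricallyProper w v g ∧
    (∃ H : (g.comp f).Homotopy (ContinuousMap.id T), IsRootedMetricallyProperHomotopy v v H) ∧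
    (∃ H : (f.comp g).Homotopy (ContinuousMap.id T'), IsRootedMetricallyProperHomotopy w w H)

/-- `(S, v)` is a rooted metrically proper deformation retract of `(T, v)`: some retraction
`r : T → S` and the inclusion `i` form a rooted metrically proper homotopy equivalence, and there is
a rooted metrically proper homotopy of `id` to `i ∘ r` that fixes every point of `S` at all
times. -/
def IsRootedMetricallyProperDeformationRetract {T : Type*} [MetricSpace T] (v : T) (S : Set T)
    (hv : v ∈ S) : Prop :=
  ∃ r : C(T, S), ∃ i : C(S, T), (∀ x : S, i x = x) ∧
    IsRootedMetricallyProperHomotopyEquiv v (⟨v, hv⟩ : S) r i ∧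
    ∃ H : (ContinuousMap.id T).HomotopyRel (i.comp r) S,
      IsRootedMetricallyProperHomotopy v v H.toHomotopy

/-! ### The tree of an inverse sequence -/

namespace InverseSequence

/-- The vertices at distance `n` from the root in the tree of the inverse sequence
`X 0 ← X 1 ← ⋯`: an extra vertex, the root, at level `0`, and the set `X n` at level `n + 1`. -/
def Level (X : ℕᵒᵖ ⥤ Type*) : ℕ → Type _
  | 0 => PUnit
  | n + 1 => X.obj (op n)

/-- The ancestor at level `m` of a vertex at level `n ≥ m`, given by the bonding maps. -/
def ancestor (X : ℕᵒᵖ ⥤ Type*) : ∀ {m n : ℕ}, m ≤ n → Level X n → Level X m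
  | 0, _, _, _ => PUnit.unit
  | _ + 1, 0, h, _ => absurd h (Nat.not_succ_le_zero _)
  | _ + 1, _ + 1, h, x => X.map (homOfLE (Nat.le_of_succ_le_succ h)).op x

/-- The geometric realization of the graph with vertices the root and the elements of the
`X n`, and with a unit edge from each vertex of level `n + 1` to its ancestor at level `n`. A point
is given by its distance `height` from the root and by the upper endpoint `vertex` of the unique
half-open edge (lower endpoint removed) that contains it; the root is its own `vertex`. -/
@[ext]
structure Tree (X : ℕᵒᵖ ⥤ Type*) where
  height : ℝ≥0
  vertex : Level X ⌈height⌉₊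

namespace Tree

variable {X : ℕᵒᵖ ⥤ Type*}

/-- The root. -/
noncomputable def root (X : ℕᵒᵖ ⥤ Type*) : Tree X :=
  ⟨0, ancestor X (Nat.ceil_zero (R := ℝ≥0)).le (PUnit.unit : Level X 0)⟩

/-- `a ≤ b` means that `a` lies on the path `[v, b]` from the root `v` to `b`. -/
instance : LE (Tree X) :=
  ⟨fun a b => ∃ h : a.height ≤ b.height, ancestor X (Nat.ceil_mono h) b.vertex = a.vertex⟩

/-- The length of the common part `[v, a] ∩ [v, b]` of the paths from the root to `a` and `b`. -/
noncomputable def meet (a b : Tree X) : ℝ≥0 := sSup (height '' {c | c ≤ a ∧ c ≤ b})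

/-- The path metric: the path from `a` to `b` descends from `a` to the point where `[v, a]` and
`[v, b]` branch and then ascends to `b`. -/
noncomputable instance : Dist (Tree X) := ⟨fun a b => a.height + b.height - 2 * meet a b⟩

lemma dist_def (a b : Tree X) : dist a b = a.height + b.height - 2 * meet a b := rfl

end Tree

lemma ancestor_self (X : ℕᵒᵖ ⥤ Type*) {n : ℕ} (h : n ≤ n) (x : Level X n) :
    ancestor X h x = x := by
  cases n with
  | zero => rfl
  | succ n =>
    have : X.map (homOfLE (Nat.le_of_succ_le_succ h)).op = 𝟙 (X.obj (op n)) := X.map_id (op n)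
    simp only [ancestor, this]
    rfl

lemma ancestor_ancestor (X : ℕᵒᵖ ⥤ Type*) {m n k : ℕ} (h : m ≤ n) (h' : n ≤ k)
    (x : Level X k) : ancestor X h (ancestor X h' x) = ancestor X (h.trans h') x := by
  match m, n, k with
  | 0, _, _ => rfl
  | m + 1, 0, _ => omega
  | m + 1, n + 1, 0 => omega
  | m + 1, n + 1, k + 1 =>
    have : (homOfLE (Nat.le_of_succ_le_succ (h.trans h'))).op =
      (homOfLE (Nat.le_of_succ_le_succ h')).op ≫ (homOfLE (Nat.le_of_succ_le_succ h)).op := rfl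
    simp only [ancestor, this, Functor.map_comp]
    rfl

namespace Tree

variable {X : ℕᵒᵖ ⥤ Type*}

lemma height_mono {a b : Tree X} (h : a ≤ b) : a.height ≤ b.height := h.1

lemma le_refl' (a : Tree X) : a ≤ a := ⟨le_rfl, ancestor_self X _ _⟩

lemma le_trans' {a b c : Tree X} (h : a ≤ b) (h' : b ≤ c) : a ≤ c :=
  ⟨h.1.trans h'.1, by rw [← h.2, ← h'.2, ancestor_ancestor]⟩

lemma eq_of_le_of_height {a b : Tree X} (h : a ≤ b) (hh : a.height = b.height) : a = b := by
  obtain ⟨s, x⟩ := a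
  obtain ⟨t, y⟩ := b
  dsimp only at hh
  subst hh
  obtain ⟨_, h2⟩ := h
  simp only [ancestor_self] at h2
  rw [h2]

/-- Points of the path to a given point are ordered by their heights. -/
lemma le_of_height_le {a b c : Tree X} (ha : a ≤ c) (hb : b ≤ c) (h : a.height ≤ b.height) :
    a ≤ b :=
  ⟨h, by rw [← ha.2, ← hb.2, ancestor_ancestor]⟩

/-- The point at height `min r |a|` of the path from the root to `a`. -/
noncomputable def cut (a : Tree X) (r : ℝ≥0) : Tree X :=
  ⟨min r a.height, ancestor X (Nat.ceil_mono (min_le_right r a.height)) a.vertex⟩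

lemma cut_le (a : Tree X) (r : ℝ≥0) : cut a r ≤ a := ⟨min_le_right _ _, rfl⟩

lemma cut_height {a : Tree X} {r : ℝ≥0} (h : r ≤ a.height) : (cut a r).height = r :=
  min_eq_left h

@[simp] lemma root_height : (root X).height = 0 := rfl

instance : Subsingleton (Level X ⌈(0 : ℝ≥0)⌉₊) := by
  rw [Nat.ceil_zero]; exact inferInstanceAs (Subsingleton PUnit)

lemma eq_root {a : Tree X} (h : a.height = 0) : a = root X := by
  obtain ⟨s, x⟩ := a
  dsimp only at h
  subst h
  unfold root
  congr 1
  exact Subsingleton.elim _ _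

lemma root_le (a : Tree X) : root X ≤ a := by
  have h := cut_le a 0
  rwa [eq_root (cut_height zero_le)] at h

/-- Two paths from the root have a common part `[v, c]`. -/
lemma exists_inf (a b : Tree X) :
    ∃ c : Tree X, c ≤ a ∧ c ≤ b ∧ c.height = meet a b ∧ ∀ d, d ≤ a → d ≤ b → d ≤ c := by
  have hbdd : BddAbove (height '' {c | c ≤ a ∧ c ≤ b}) :=
    ⟨a.height, by rintro _ ⟨c, hc, rfl⟩; exact hc.1.1⟩
  have hne : (height '' {c | c ≤ a ∧ c ≤ b}).Nonempty :=
    ⟨_, root X, ⟨root_le a, root_le b⟩, rfl⟩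
  have hma : meet a b ≤ a.height := csSup_le hne (by rintro _ ⟨c, hc, rfl⟩; exact hc.1.1)
  have hmb : meet a b ≤ b.height := csSup_le hne (by rintro _ ⟨c, hc, rfl⟩; exact hc.2.1)
  have key : cut a (meet a b) ≤ b := by
    rcases eq_or_ne (meet a b) 0 with h0 | h0
    · rw [h0, eq_root (cut_height zero_le)]; exact root_le b
    · have hpos : 0 < meet a b := pos_iff_ne_zero.2 h0
      obtain ⟨k, hk⟩ : ∃ k, ⌈meet a b⌉₊ = k + 1 :=
        Nat.exists_eq_succ_of_ne_zero (Nat.ceil_pos.2 hpos).ne'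
      have hlt : (k : ℝ≥0) < meet a b := by
        have := Nat.lt_ceil (a := meet a b) (n := k)
        exact this.1 (by omega)
      obtain ⟨_, ⟨c, hc, rfl⟩, hck⟩ := exists_lt_of_lt_csSup hne hlt
      have hcm : c.height ≤ meet a b := le_csSup hbdd ⟨c, hc, rfl⟩
      have hcc : ⌈c.height⌉₊ = ⌈meet a b⌉₊ := by
        apply le_antisymm (Nat.ceil_mono hcm)
        rw [hk]; exact Nat.succ_le_of_lt (Nat.lt_ceil.2 hck)
      have hcc' : ⌈(cut a (meet a b)).height⌉₊ ≤ ⌈c.height⌉₊ := by rw [cut_height hma, hcc]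
      refine ⟨by rw [cut_height hma]; exact hmb, ?_⟩
      have h1 : ancestor X (hcc'.trans (Nat.ceil_mono hc.1.1)) a.vertex =
          ancestor X (hcc'.trans (Nat.ceil_mono hc.2.1)) b.vertex := by
        rw [← ancestor_ancestor X hcc' (Nat.ceil_mono hc.1.1),
          ← ancestor_ancestor X hcc' (Nat.ceil_mono hc.2.1), hc.1.2, hc.2.2]
      exact h1.symm
  refine ⟨cut a (meet a b), cut_le _ _, key, cut_height hma, fun d hda hdb => ?_⟩
  refine le_of_height_le hda (cut_le _ _) ?_
  rw [cut_height hma]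
  exact le_csSup hbdd ⟨d, ⟨hda, hdb⟩, rfl⟩

lemma meet_comm (a b : Tree X) : meet a b = meet b a := by
  unfold meet; congr 2; ext c; exact and_comm

lemma height_le_meet {a b d : Tree X} (ha : d ≤ a) (hb : d ≤ b) : d.height ≤ meet a b := by
  obtain ⟨c, -, -, hc, h⟩ := exists_inf a b
  rw [← hc]; exact (h d ha hb).1

lemma meet_le_left (a b : Tree X) : meet a b ≤ a.height := by
  obtain ⟨c, h, -, hc, -⟩ := exists_inf a b
  rw [← hc]; exact h.1

lemma meet_le_right (a b : Tree X) : meet a b ≤ b.height := by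
  rw [meet_comm]; exact meet_le_left b a

lemma meet_eq_of_le {a b : Tree X} (h : a ≤ b) : meet a b = a.height :=
  le_antisymm (meet_le_left a b) (height_le_meet (le_refl' a) h)

/-- The ultrametric-type inequality behind the triangle inequality. -/
lemma min_meet_le (a b c : Tree X) : min (meet a b) (meet b c) ≤ meet a c := by
  obtain ⟨p, pa, pb, hp, -⟩ := exists_inf a b
  obtain ⟨q, qb, qc, hq, -⟩ := exists_inf b c
  rw [← hp, ← hq]
  rcases le_total p.height q.height with h | h
  · rw [min_eq_left h]
    exact height_le_meet pa (le_trans' (le_of_height_le pb qb h) qc)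
  · rw [min_eq_right h]
    exact height_le_meet (le_trans' (le_of_height_le qb pb h) pa) qc

noncomputable instance : MetricSpace (Tree X) where
  dist_self a := by rw [dist_def, meet_eq_of_le (le_refl' a)]; ring
  dist_comm a b := by rw [dist_def, dist_def, meet_comm]; ring
  dist_triangle a b c := by
    rw [dist_def, dist_def, dist_def]
    have h1 : (meet a b : ℝ) ≤ b.height := mod_cast meet_le_right a b
    have h2 : (meet b c : ℝ) ≤ b.height := mod_cast meet_le_left b c
    have h3 := min_meet_le a b c
    rcases min_le_iff.1 h3 with h | h
    · have : (meet a b : ℝ) ≤ meet a c := mod_cast h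
      linarith
    · have : (meet b c : ℝ) ≤ meet a c := mod_cast h
      linarith
  eq_of_dist_eq_zero := by
    intro a b h
    rw [dist_def] at h
    have h1 : (meet a b : ℝ) ≤ a.height := mod_cast meet_le_left a b
    have h2 : (meet a b : ℝ) ≤ b.height := mod_cast meet_le_right a b
    obtain ⟨c, ca, cb, hc, -⟩ := exists_inf a b
    have ha : c.height = a.height := by rw [hc]; exact NNReal.coe_injective (by linarith)
    have hb : c.height = b.height := by rw [hc]; exact NNReal.coe_injective (by linarith)
    rw [← eq_of_le_of_height ca ha, ← eq_of_le_of_height cb hb]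

lemma meet_of_dist {a b : Tree X} : 2 * (meet a b : ℝ) = a.height + b.height - dist a b := by
  rw [dist_def]; ring

lemma dist_of_le {a b : Tree X} (h : a ≤ b) : dist a b = b.height - a.height := by
  rw [dist_def, meet_eq_of_le h]; ring

lemma le_iff_dist {a b : Tree X} : a ≤ b ↔ dist a b = b.height - a.height := by
  refine ⟨dist_of_le, fun h => ?_⟩
  obtain ⟨c, ca, cb, hc, -⟩ := exists_inf a b
  have h2 := meet_of_dist (a := a) (b := b)
  have ha : c.height = a.height := by rw [hc]; exact NNReal.coe_injective (by linarith)
  rwa [← eq_of_le_of_height ca ha]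

lemma dist_root (a : Tree X) : dist (root X) a = a.height := by
  rw [dist_of_le (root_le a)]; simp

lemma continuous_height : Continuous fun a : Tree X => (a.height : ℝ) := by
  simp_rw [← dist_root]
  fun_prop

lemma continuous_meet (x : Tree X) : Continuous fun a : Tree X => (meet a x : ℝ) := by
  have : (fun a : Tree X => (meet a x : ℝ)) =
      fun a => ((a.height : ℝ) + x.height - dist a x) / 2 := by
    ext a; rw [← meet_of_dist]; ring
  rw [this]
  have := continuous_height (X := X)
  fun_prop

/-- A point of the path from `x` down to the branching point of `x` and `y` separates them. -/
lemma mem_range_path {x y z : Tree X} (γ : Path x y) (hz : z ≤ x) (hm : meet x y ≤ z.height) :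
    z ∈ range γ := by
  by_contra hcon
  have hzx : z.height < x.height := by
    refine lt_of_le_of_ne hz.1 fun h => hcon ?_
    rw [eq_of_le_of_height hz h]; exact ⟨0, γ.source⟩
  set D : Set (Tree X) := {w | (z.height : ℝ) < meet w x} with hD
  have hopen : IsOpen D := isOpen_lt continuous_const (continuous_meet x)
  have hclos : closure D ⊆ D ∪ {z} := by
    intro w hw
    by_contra hwn
    simp only [mem_union, mem_singleton_iff, not_or] at hwn
    obtain ⟨hwD, hwz⟩ := hwn
    have hpos : 0 < dist w z := dist_pos.2 hwz
    obtain ⟨w', hw', hd⟩ := Metric.mem_closure_iff.1 hw _ hpos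
    have hw'm : z.height < meet w' x := by exact_mod_cast hw'
    have hwm : meet w x ≤ z.height := by
      have : ¬ (z.height : ℝ) < meet w x := hwD
      exact_mod_cast not_lt.1 this
    obtain ⟨q, qw, qx, hq, -⟩ := exists_inf w' x
    have hzq : z ≤ q := le_of_height_le hz qx (by rw [hq]; exact hw'm.le)
    have hzw' : z ≤ w' := le_trans' hzq qw
    obtain ⟨p, pw, pw', hp, -⟩ := exists_inf w w'
    have hpz : p.height ≤ z.height := by
      by_contra hlt
      push Not at hlt
      rcases le_total p.height q.height with h | h
      · have := height_le_meet pw (le_trans' (le_of_height_le pw' qw h) qx)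
        exact absurd (hlt.trans_le (this.trans hwm)) (lt_irrefl _)
      · have := height_le_meet (le_trans' (le_of_height_le qw pw' h) pw) qx
        rw [hq] at this
        exact absurd (hw'm.trans_le (this.trans hwm)) (lt_irrefl _)
    have h1 : (meet w w' : ℝ) ≤ meet w z := by
      have := height_le_meet pw (le_of_height_le pw' hzw' hpz)
      rw [hp] at this; exact_mod_cast this
    have h2 : (z.height : ℝ) ≤ w'.height := by exact_mod_cast hzw'.1
    have h3 := dist_def w w'
    have h4 := dist_def w z
    linarith
  have hcl : IsClopen (γ ⁻¹' D) := by
    refine ⟨?_, hopen.preimage γ.continuous⟩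
    have : γ ⁻¹' D = γ ⁻¹' closure D := by
      refine Subset.antisymm (preimage_mono subset_closure) fun s hs => ?_
      rcases hclos hs with h | h
      · exact h
      · exact absurd ⟨s, h⟩ hcon
    rw [this]
    exact isClosed_closure.preimage γ.continuous
  have h0 : (0 : I) ∈ γ ⁻¹' D := by
    simp only [mem_preimage, γ.source, hD, mem_ofPred_eq, meet_eq_of_le (le_refl' x)]
    exact_mod_cast hzx
  have h1 : (1 : I) ∈ γ ⁻¹' D := by rw [hcl.eq_univ ⟨0, h0⟩]; trivial
  simp only [mem_preimage, γ.target, hD, mem_ofPred_eq, meet_comm y x] at h1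
  exact absurd hm (not_le.2 (by exact_mod_cast h1))

/-- The geodesic segment between two points. -/
def seg (x y : Tree X) : Set (Tree X) := {z | (z ≤ x ∨ z ≤ y) ∧ meet x y ≤ z.height}

lemma seg_comm (x y : Tree X) : seg x y = seg y x := by
  ext z; simp only [seg, mem_ofPred_eq, meet_comm x y, or_comm]

lemma seg_subset_range {x y : Tree X} (γ : Path x y) : seg x y ⊆ range γ := by
  rintro z ⟨h | h, hm⟩
  · exact mem_range_path γ h hm
  · obtain ⟨s, hs⟩ := mem_range_path γ.symm h (by rwa [meet_comm])
    exact ⟨_, hs⟩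

lemma seg_root (x : Tree X) : seg (root X) x = {z | z ≤ x} := by
  ext z
  simp only [seg, mem_ofPred_eq, meet_eq_of_le (root_le x), root_height, zero_le, and_true]
  exact ⟨fun h => h.elim (fun h => le_trans' h (root_le x)) id, Or.inr⟩

/-- The distance of a point of the segment to the first endpoint determines the point. -/
noncomputable def geo (x y : Tree X) (s : ℝ) : Tree X :=
  if s ≤ x.height - meet x y then cut x (x.height - s).toNNReal
  else cut y (s - x.height + 2 * meet x y).toNNReal

lemma dist_cut_cut {x : Tree X} {r s : ℝ≥0} (hr : r ≤ x.height) (hs : s ≤ x.height) :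
    dist (cut x r) (cut x s) = |(r : ℝ) - s| := by
  rcases le_total r s with h | h
  · rw [dist_of_le (le_of_height_le (cut_le x r) (cut_le x s)
      (by rwa [cut_height hr, cut_height hs])), cut_height hr, cut_height hs, abs_sub_comm,
      abs_of_nonneg (sub_nonneg.2 (by exact_mod_cast h))]
  · rw [dist_comm, dist_of_le (le_of_height_le (cut_le x s) (cut_le x r)
      (by rwa [cut_height hr, cut_height hs])), cut_height hr, cut_height hs,
      abs_of_nonneg (sub_nonneg.2 (by exact_mod_cast h))]

lemma dist_cut_cut' {x y : Tree X} {r s : ℝ≥0} (hr : r ≤ x.height) (hs : s ≤ y.height)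
    (hmr : meet x y ≤ r) (hms : meet x y ≤ s) :
    dist (cut x r) (cut y s) = r + s - 2 * meet x y := by
  have : meet (cut x r) (cut y s) = meet x y := by
    apply le_antisymm
    · obtain ⟨c, ca, cb, hc, -⟩ := exists_inf (cut x r) (cut y s)
      rw [← hc]
      exact height_le_meet (le_trans' ca (cut_le _ _)) (le_trans' cb (cut_le _ _))
    · obtain ⟨c, ca, cb, hc, -⟩ := exists_inf x y
      rw [← hc]
      refine height_le_meet (le_of_height_le ca (cut_le _ _) ?_)
        (le_of_height_le cb (cut_le _ _) ?_)
      · rwa [cut_height hr, hc]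
      · rwa [cut_height hs, hc]
  rw [dist_def, this, cut_height hr, cut_height hs]

lemma cut_height_of_le {z x : Tree X} (h : z ≤ x) : cut x z.height = z :=
  eq_of_le_of_height (le_of_height_le (cut_le _ _) h (by rw [cut_height h.1])) (cut_height h.1)

lemma isometry_geo (x y : Tree X) :
    Isometry fun s : Icc (0 : ℝ) (dist x y) => geo x y s := by
  have hmx : (meet x y : ℝ) ≤ x.height := mod_cast meet_le_left x y
  have hmy : (meet x y : ℝ) ≤ y.height := mod_cast meet_le_right x y
  have hm0 : (0 : ℝ) ≤ meet x y := (meet x y).2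
  have hd := dist_def x y
  -- the order of the two parameters does not matter
  have key : ∀ s t : ℝ, 0 ≤ s → s ≤ t → t ≤ dist x y → dist (geo x y s) (geo x y t) = t - s := by
    intro s t hs hst ht
    unfold geo
    have e1 : s ≤ x.height - meet x y → (x.height - s).toNNReal ≤ x.height ∧
        meet x y ≤ (x.height - s).toNNReal ∧ ((x.height - s).toNNReal : ℝ) = x.height - s := by
      intro h
      have e : ((x.height - s).toNNReal : ℝ) = x.height - s :=
        Real.coe_toNNReal _ (by linarith)
      refine ⟨?_, ?_, e⟩ <;> rw [← NNReal.coe_le_coe, e] <;> linarith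
    have e2 : ¬ t ≤ x.height - meet x y → (t - x.height + 2 * meet x y).toNNReal ≤ y.height ∧
        meet x y ≤ (t - x.height + 2 * meet x y).toNNReal ∧
        ((t - x.height + 2 * meet x y).toNNReal : ℝ) = t - x.height + 2 * meet x y := by
      intro h
      push Not at h
      have e : ((t - x.height + 2 * meet x y).toNNReal : ℝ) = t - x.height + 2 * meet x y :=
        Real.coe_toNNReal _ (by linarith)
      refine ⟨?_, ?_, e⟩ <;> rw [← NNReal.coe_le_coe, e] <;> linarith
    by_cases ht' : t ≤ x.height - meet x y
    · have hs' := hst.trans ht'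
      have et : ((x.height - t).toNNReal : ℝ) = x.height - t :=
        Real.coe_toNNReal _ (by linarith)
      rw [if_pos hs', if_pos ht', dist_cut_cut (e1 hs').1, (e1 hs').2.2, et,
        abs_of_nonneg (by linarith)]
      · ring
      · rw [← NNReal.coe_le_coe, et]; linarith
    · rw [if_neg ht']
      by_cases hs' : s ≤ x.height - meet x y
      · rw [if_pos hs', dist_cut_cut' (e1 hs').1 (e2 ht').1 (e1 hs').2.1 (e2 ht').2.1,
          (e1 hs').2.2, (e2 ht').2.2]
        ring
      · have es : ((s - x.height + 2 * meet x y).toNNReal : ℝ) = s - x.height + 2 * meet x y :=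
          Real.coe_toNNReal _ (by push Not at hs'; linarith)
        rw [if_neg hs', dist_comm, dist_cut_cut (e2 ht').1, (e2 ht').2.2, es,
          abs_of_nonneg (by linarith)]
        · ring
        · rw [← NNReal.coe_le_coe, es]; linarith
  refine Isometry.of_dist_eq fun s t => ?_
  rw [Subtype.dist_eq, Real.dist_eq]
  rcases le_total (s : ℝ) t with h | h
  · rw [key s t s.2.1 h t.2.2, abs_sub_comm, abs_of_nonneg (by linarith)]
  · rw [dist_comm, key t s t.2.1 h s.2.2, abs_of_nonneg (by linarith)]

lemma range_geo (x y : Tree X) :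
    range (fun s : Icc (0 : ℝ) (dist x y) => geo x y s) = seg x y := by
  have hmx : (meet x y : ℝ) ≤ x.height := mod_cast meet_le_left x y
  have hmy : (meet x y : ℝ) ≤ y.height := mod_cast meet_le_right x y
  have hm0 : (0 : ℝ) ≤ meet x y := (meet x y).2
  have hd := dist_def x y
  ext z
  constructor
  · rintro ⟨⟨s, hs0, hs1⟩, rfl⟩
    simp only [geo]
    split_ifs with h
    · refine ⟨Or.inl (cut_le _ _), ?_⟩
      have e : ((x.height - s).toNNReal : ℝ) = x.height - s := Real.coe_toNNReal _ (by linarith)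
      rw [cut_height, ← NNReal.coe_le_coe, e]
      · linarith
      · rw [← NNReal.coe_le_coe, e]; linarith
    · push Not at h
      refine ⟨Or.inr (cut_le _ _), ?_⟩
      have e : ((s - x.height + 2 * meet x y).toNNReal : ℝ) = s - x.height + 2 * meet x y :=
        Real.coe_toNNReal _ (by linarith)
      rw [cut_height, ← NNReal.coe_le_coe, e]
      · linarith
      · rw [← NNReal.coe_le_coe, e]; linarith
  · have left : ∀ z, z ≤ x → meet x y ≤ z.height →
        z ∈ range (fun s : Icc (0 : ℝ) (dist x y) => geo x y s) := by
      intro z h hm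
      have h1 : (z.height : ℝ) ≤ x.height := by exact_mod_cast h.1
      have h2 : (meet x y : ℝ) ≤ z.height := by exact_mod_cast hm
      refine ⟨⟨x.height - z.height, by linarith, by linarith⟩, ?_⟩
      simp only [geo]
      rw [if_pos (by linarith), sub_sub_cancel, Real.toNNReal_coe, cut_height_of_le h]
    rintro ⟨h | h, hm⟩
    · exact left z h hm
    · have h1 : (z.height : ℝ) ≤ y.height := by exact_mod_cast h.1
      have h2 : (meet x y : ℝ) ≤ z.height := by exact_mod_cast hm
      rcases h2.eq_or_lt with h3 | h3
      · obtain ⟨c, ca, cb, hc, -⟩ := exists_inf x y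
        have hzc : z.height = c.height := by rw [hc]; exact NNReal.coe_injective h3.symm
        have : z = c := eq_of_le_of_height (le_of_height_le h cb hzc.le) hzc
        exact left z (this ▸ ca) hm
      · refine ⟨⟨z.height + x.height - 2 * meet x y, by linarith, by linarith⟩, ?_⟩
        simp only [geo]
        rw [if_neg (by push Not; linarith)]
        have : (z.height : ℝ) + x.height - 2 * meet x y - x.height + 2 * meet x y = z.height := by
          ring
        rw [this, Real.toNNReal_coe, cut_height_of_le h]

/-- Every arc between two points is the geodesic segment. -/
lemma range_eq_seg {x y : Tree X} (γ : Path x y) (hγ : Function.Injective γ) :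
    range γ = seg x y := by
  refine Subset.antisymm ?_ (seg_subset_range γ)
  have hemb : Topology.IsClosedEmbedding γ := γ.continuous.isClosedEmbedding hγ
  have hconn : _root_.IsPreconnected (γ ⁻¹' seg x y) := by
    rw [← hemb.isInducing.isPreconnected_image, image_preimage_eq_of_subset (seg_subset_range γ),
      ← range_geo]
    have : PreconnectedSpace (Icc (0 : ℝ) (dist x y)) :=
      Subtype.preconnectedSpace isPreconnected_Icc
    exact isPreconnected_range (isometry_geo x y).continuous
  have h0 : (0 : I) ∈ γ ⁻¹' seg x y := by
    simp only [mem_preimage, γ.source]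
    exact ⟨Or.inl (le_refl' x), meet_le_left x y⟩
  have h1 : (1 : I) ∈ γ ⁻¹' seg x y := by
    simp only [mem_preimage, γ.target]
    exact ⟨Or.inr (le_refl' y), meet_le_right x y⟩
  rintro _ ⟨s, rfl⟩
  exact hconn.ordConnected.out h0 h1 ⟨s.2.1, s.2.2⟩

/-- The geodesic as an injective path. -/
lemma exists_path {x y : Tree X} (hxy : x ≠ y) :
    ∃ γ : Path x y, Function.Injective γ ∧ range γ = seg x y := by
  have hd : 0 < dist x y := dist_pos.2 hxy
  have hmem : ∀ s : I, (s : ℝ) * dist x y ∈ Icc (0 : ℝ) (dist x y) := fun s =>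
    ⟨mul_nonneg s.2.1 hd.le, mul_le_of_le_one_left hd.le s.2.2⟩
  have hmx : (meet x y : ℝ) ≤ x.height := mod_cast meet_le_left x y
  have hmy : (meet x y : ℝ) ≤ y.height := mod_cast meet_le_right x y
  have hdd := dist_def x y
  have hg0 : geo x y 0 = x := by
    simp only [geo]
    rw [if_pos (by linarith), sub_zero, Real.toNNReal_coe, cut_height_of_le (le_refl' x)]
  have hg1 : geo x y (dist x y) = y := by
    simp only [geo]
    split_ifs with h
    · have h1 : y.height = meet x y := NNReal.coe_injective (by linarith)
      obtain ⟨c, ca, cb, hc, -⟩ := exists_inf x y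
      have hcy : c = y := eq_of_le_of_height cb (by rw [hc, h1])
      have h2 : (x.height : ℝ) - dist x y = y.height := by rw [hdd, h1]; ring
      rw [h2, Real.toNNReal_coe, cut_height_of_le (hcy ▸ ca)]
    · have h2 : dist x y - x.height + 2 * meet x y = y.height := by rw [hdd]; ring
      rw [h2, Real.toNNReal_coe, cut_height_of_le (le_refl' y)]
  let γ : Path x y :=
    { toFun := fun s => geo x y (⟨s * dist x y, hmem s⟩ : Icc (0 : ℝ) (dist x y))
      continuous_toFun := (isometry_geo x y).continuous.comp (by fun_prop)
      source' := by simpa using hg0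
      target' := by simpa using hg1 }
  have hinj : Function.Injective γ := by
    intro s t hst
    have h := (isometry_geo x y).injective hst
    have h' : (s : ℝ) * dist x y = t * dist x y := congrArg Subtype.val h
    exact Subtype.ext (mul_right_cancel₀ hd.ne' h')
  exact ⟨γ, hinj, range_eq_seg γ hinj⟩

/-- A subset that contains with each point the path to the root is a real tree. -/
lemma isRealTree_of_lower {S : Set (Tree X)} (hS : ∀ a b, a ≤ b → b ∈ S → a ∈ S) :
    IsRealTree S := by
  have hseg : ∀ x y : S, seg (x : Tree X) y ⊆ S := by
    rintro x y z ⟨h | h, -⟩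
    · exact hS _ _ h x.2
    · exact hS _ _ h y.2
  have harc : ∀ (x y : S) (A : Set S), IsArc x y A → A = Subtype.val ⁻¹' seg (x : Tree X) y := by
    rintro x y _ ⟨γ, hγ, rfl⟩
    have h := range_eq_seg (γ.map continuous_subtype_val)
      (Subtype.val_injective.comp hγ)
    rw [← h]
    ext z
    simp [Subtype.ext_iff]
  refine ⟨fun x y hxy => ?_, fun x y A hA => ?_⟩
  · obtain ⟨γ, hγ, hr⟩ := exists_path (fun h => hxy (Subtype.ext h) : (x : Tree X) ≠ y)
    have hm : ∀ s, γ s ∈ S := fun s => hseg x y (hr ▸ mem_range_self s)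
    let δ : Path x y :=
      { toFun := fun s => ⟨γ s, hm s⟩
        continuous_toFun := γ.continuous.subtype_mk hm
        source' := Subtype.ext γ.source
        target' := Subtype.ext γ.target }
    have hδ : IsArc x y (range δ) :=
      ⟨δ, fun s t h => hγ (congrArg Subtype.val h), rfl⟩
    refine ⟨range δ, hδ, fun B hB => ?_⟩
    rw [harc x y _ hδ, harc x y B hB]
  · have hA' := harc x y A hA
    have hgm : ∀ s : Icc (0 : ℝ) (dist (x : Tree X) y), geo (x : Tree X) y s ∈ seg (x : Tree X) y :=
      fun s => by rw [← range_geo]; exact ⟨s, rfl⟩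
    let g : Icc (0 : ℝ) (dist x y) → A := fun s =>
      ⟨⟨geo (x : Tree X) y s, hseg x y (hgm s)⟩, by rw [hA']; exact hgm s⟩
    have hg : Isometry g := Isometry.of_dist_eq fun s t => (isometry_geo (x : Tree X) y).dist_eq s t
    have hsurj : Function.Surjective g := by
      rintro ⟨⟨z, hzS⟩, hz⟩
      rw [hA'] at hz
      have hz' : z ∈ seg (x : Tree X) y := hz
      rw [← range_geo] at hz'
      obtain ⟨s, hs⟩ := hz'
      exact ⟨s, Subtype.ext (Subtype.ext hs)⟩
    exact ⟨(IsometryEquiv.mk (Equiv.ofBijective g ⟨hg.injective, hsurj⟩) hg).symm⟩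

lemma lower_of_isRealTree {S : Set (Tree X)} (hv : root X ∈ S) (hS : IsRealTree S)
    {a b : Tree X} (hab : a ≤ b) (hb : b ∈ S) : a ∈ S := by
  by_cases h : root X = b
  · have : a.height = 0 := by
      have := hab.1
      rw [← h] at this
      exact le_antisymm this zero_le
    rwa [eq_root this]
  · obtain ⟨A, ⟨γ, hγ, -⟩, -⟩ := hS.existsUnique_arc ⟨root X, hv⟩ ⟨b, hb⟩
      (fun h' => h (congrArg Subtype.val h'))
    have hr := range_eq_seg (γ.map continuous_subtype_val) (Subtype.val_injective.comp hγ)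
    rw [seg_root] at hr
    obtain ⟨s, hs⟩ : a ∈ range (γ.map continuous_subtype_val) := by rw [hr]; exact hab
    rw [← hs]
    exact (γ s).2

/-- The tree of an inverse sequence is a real tree. -/
theorem isRealTree (X : ℕᵒᵖ ⥤ Type*) : IsRealTree (Tree X) where
  existsUnique_arc x y h := by
    obtain ⟨γ, hγ, hr⟩ := exists_path h
    refine ⟨seg x y, ⟨γ, hγ, hr⟩, ?_⟩
    rintro B ⟨δ, hδ, rfl⟩
    exact range_eq_seg δ hδ
  isometric_arc x y A := by
    rintro ⟨δ, hδ, rfl⟩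
    rw [range_eq_seg δ hδ, ← range_geo]
    exact ⟨(isometry_geo x y).isometryEquivOnRange.symm⟩

/-- `T_∞` is the greatest geodesically complete subtree. -/
theorem isGreatest_maximalGCSubtree (X : ℕᵒᵖ ⥤ Type*) :
    IsGreatest {S | IsGeodesicallyCompleteSubtree (root X) S} (maximalGCSubtree (root X)) := by
  refine ⟨?_, fun S hS => subset_sUnion_of_mem hS⟩
  have hroot : root X ∈ maximalGCSubtree (root X) := by
    refine ⟨{root X}, ⟨rfl, isRealTree_of_lower ?_, ?_⟩, rfl⟩
    · rintro a b hab rfl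
      exact eq_root (le_antisymm hab.1 zero_le)
    · intro t ht f hf _
      have h := hf.injective (Subsingleton.elim (f ⟨0, le_rfl, ht.le⟩) (f ⟨t, ht.le, le_rfl⟩))
      exact absurd (congrArg Subtype.val h) ht.ne
  refine ⟨hroot, isRealTree_of_lower ?_, ?_⟩
  · rintro a b hab ⟨S, hS, hb⟩
    exact ⟨S, hS, lower_of_isRealTree hS.1 hS.2.1 hab hb⟩
  · intro t ht f hf hf0
    obtain ⟨S, hS, hfS⟩ := (f ⟨t, ht.le, le_rfl⟩).2
    have hd : ∀ s s', dist (f s : Tree X) (f s') = |(s : ℝ) - s'| := fun s s' => hf.dist_eq s s'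
    have hheight : ∀ s, ((f s : Tree X).height : ℝ) = s := by
      intro s
      have h := hd ⟨0, le_rfl, ht.le⟩ s
      rw [hf0, dist_root] at h
      rw [h, zero_sub, abs_neg, abs_of_nonneg s.2.1]
    have hle : ∀ s, (f s : Tree X) ≤ f ⟨t, ht.le, le_rfl⟩ := by
      intro s
      rw [le_iff_dist, hd, hheight, hheight, abs_sub_comm, abs_of_nonneg]
      exact sub_nonneg.2 s.2.2
    have hmem : ∀ s, (f s : Tree X) ∈ S := fun s =>
      lower_of_isRealTree hS.1 hS.2.1 (hle s) hfS
    have hf0' : (f ⟨0, le_rfl, ht.le⟩ : Tree X) = root X := by rw [hf0]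
    obtain ⟨g, hg, hgf⟩ := hS.2.2 t ht (fun s => ⟨f s, hmem s⟩)
      (Isometry.of_dist_eq fun s s' => hf.dist_eq s s')
      (Subtype.ext hf0')
    refine ⟨fun s => ⟨g s, S, hS, (g s).2⟩, Isometry.of_dist_eq fun s s' => hg.dist_eq s s',
      fun s => Subtype.ext (congrArg (fun z : S => (z : Tree X)) (hgf s) :)⟩

lemma root_mem_maximalGCSubtree (X : ℕᵒᵖ ⥤ Type*) : root X ∈ maximalGCSubtree (root X) :=
  (isGreatest_maximalGCSubtree X).1.1

end Tree

end InverseSequence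

/-! Call a point persistent if points of arbitrarily large height lie above it. A vertex is
persistent exactly when it is in the image of every later level, so the Mittag-Leffler condition
says: for each `h`, the paths to all sufficiently high points pass height `h` at a persistent point
(`isMittagLeffler_iff`).

Assume this condition. A persistent point then has a persistent point one unit above it, and
iteration gives a ray. Hence `T_∞` consists of the persistent points and the root
(`maximalGCSubtree_eq`). Without the condition only one inclusion is clear: a persistent point may
carry longer and longer finite branches and no ray. The path to a point `a` leaves the closed
subtree `T_∞` at a last point, and sliding `a` down to it is a deformation retraction. It is
metrically proper because the exit height tends to infinity with the height of `a`, which is again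
the Mittag-Leffler condition.

Conversely, let `f`, `g` be an equivalence and let `a` be very high. Properness keeps the track of
the homotopy from `a` to `g (f a)` above height `h`. From `f a` a ray of `T_∞` goes to infinity, and
`g` maps its tail to a path above height `h` that reaches every height. In a tree, a path above
height `h` cannot change branch at height `h` (`cut_le_of_joinedIn`), so the point at height `h`
below `a` is persistent. -/

namespace InverseSequence

namespace Tree

variable {X : ℕᵒᵖ ⥤ Type*}

/-! ### Vertices and truncated paths -/

/-- The point of the tree given by a vertex. -/
noncomputable def ofVertex {n : ℕ} (x : Level X n) : Tree X :=
  ⟨n, ancestor X (Nat.ceil_natCast (R := ℝ≥0) n).le x⟩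

lemma le_ceil_height {a : Tree X} {n : ℕ} (h : (n : ℝ≥0) ≤ a.height) : n ≤ ⌈a.height⌉₊ :=
  Nat.cast_le.1 (h.trans (Nat.le_ceil _))

/-- The vertex of level `n` on the path from the root to `a`. -/
noncomputable def vertexAt (a : Tree X) {n : ℕ} (h : (n : ℝ≥0) ≤ a.height) : Level X n :=
  ancestor X (le_ceil_height h) a.vertex

lemma vertexAt_ofVertex {n m : ℕ} (x : Level X n) (h : (m : ℝ≥0) ≤ (ofVertex x).height) :
    (ofVertex x).vertexAt h = ancestor X (Nat.cast_le.1 h) x :=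
  ancestor_ancestor X _ _ x

lemma ancestor_vertexAt {a : Tree X} {m n : ℕ} (hmn : m ≤ n) (h : (n : ℝ≥0) ≤ a.height) :
    ancestor X hmn (a.vertexAt h) = a.vertexAt ((Nat.cast_le.2 hmn).trans h) :=
  ancestor_ancestor X _ _ _

lemma vertexAt_of_le {a b : Tree X} (hab : a ≤ b) {n : ℕ} (h : (n : ℝ≥0) ≤ a.height) :
    b.vertexAt (h.trans hab.1) = a.vertexAt h := by
  unfold vertexAt
  rw [← hab.2, ancestor_ancestor]

lemma ofVertex_vertexAt_le {a : Tree X} {n : ℕ} (h : (n : ℝ≥0) ≤ a.height) :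
    ofVertex (a.vertexAt h) ≤ a :=
  ⟨h, (ancestor_ancestor X _ _ _).symm⟩

lemma cut_natCast {a : Tree X} {n : ℕ} (h : (n : ℝ≥0) ≤ a.height) :
    cut a n = ofVertex (a.vertexAt h) :=
  eq_of_le_of_height (le_of_height_le (cut_le _ _) (ofVertex_vertexAt_le h) (cut_height h).le)
    (cut_height h)

/-- With `c ≤ a`, the bound on the ceilings puts `a` and `c` on the same half-open edge. Points of
one half-open edge have the same points above them, up to the condition on heights. -/
lemma le_of_ceil_height_eq {a b c : Tree X} (hca : c ≤ a) (hcb : c ≤ b)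
    (hc : ⌈a.height⌉₊ ≤ ⌈c.height⌉₊) (hab : a.height ≤ b.height) : a ≤ b := by
  refine ⟨hab, ?_⟩
  rw [← ancestor_ancestor X hc (Nat.ceil_mono hcb.1), hcb.2, ← hca.2, ancestor_ancestor,
    ancestor_self]

lemma cut_le_cut (a : Tree X) {r s : ℝ≥0} (h : r ≤ s) : cut a r ≤ cut a s :=
  le_of_height_le (cut_le _ _) (cut_le _ _) (min_le_min_right _ h)

lemma le_cut {a b : Tree X} (h : a ≤ b) {r : ℝ≥0} (hr : a.height ≤ r) : a ≤ cut b r :=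
  le_of_height_le h (cut_le _ _) (le_min hr h.1)

lemma cut_of_height_le {a : Tree X} {r : ℝ≥0} (h : a.height ≤ r) : cut a r = a :=
  eq_of_le_of_height (cut_le _ _) (min_eq_right h)

lemma cut_eq_cut_of_le {a b : Tree X} (h : a ≤ b) {r : ℝ≥0} (hr : r ≤ a.height) :
    cut a r = cut b r :=
  eq_of_le_of_height (le_cut (le_trans' (cut_le _ _) h) (cut_height hr).le)
    (by rw [cut_height hr, cut_height (hr.trans h.1)])

/-! ### Persistent points and the Mittag-Leffler condition -/

/-- The points with points of arbitrarily large height above them. -/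
def persistent (X : ℕᵒᵖ ⥤ Type*) : Set (Tree X) :=
  {a | ∀ n : ℕ, ∃ b, a ≤ b ∧ (n : ℝ≥0) ≤ b.height}

lemma persistent_of_le {a b : Tree X} (hab : a ≤ b) (hb : b ∈ persistent X) :
    a ∈ persistent X := fun n => by
  obtain ⟨c, hc, hn⟩ := hb n
  exact ⟨c, le_trans' hab hc, hn⟩

/-- The shift by one appears because `X j` sits at level `j + 1`, level `0` being the root. The
inclusion is the whole condition: images decrease as the level grows, so for `k ≥ n` it amounts to
equality. -/
lemma isMittagLeffler_iff_ancestor : X.IsMittagLeffler ↔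
    ∀ j : ℕ, ∃ (n : ℕ) (h : j + 1 ≤ n), ∀ (k : ℕ) (h' : j + 1 ≤ k),
      range (ancestor X h) ⊆ range (ancestor X h') := by
  constructor
  · intro hX j
    obtain ⟨⟨i⟩, f, hf⟩ := hX (op j)
    refine ⟨i + 1, Nat.succ_le_succ (leOfHom f.unop), fun k h' => ?_⟩
    obtain ⟨k, rfl⟩ : ∃ l, k = l + 1 := ⟨k - 1, by omega⟩
    exact hf (homOfLE (Nat.le_of_succ_le_succ h')).op
  · rintro hX ⟨j⟩
    obtain ⟨i, h, hi⟩ := hX j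
    obtain ⟨i, rfl⟩ : ∃ l, i = l + 1 := ⟨i - 1, by omega⟩
    exact ⟨op i, (homOfLE (Nat.le_of_succ_le_succ h)).op,
      fun ⟨k⟩ g => hi (k + 1) (Nat.succ_le_succ (leOfHom g.unop))⟩

/-- This is the only form in which the condition is used below. Stable images are images of
persistent vertices, and heights between two vertices are handled by rounding up, since points below
persistent points are persistent. -/
theorem isMittagLeffler_iff : X.IsMittagLeffler ↔
    ∀ h : ℝ≥0, ∃ n : ℕ, ∀ a : Tree X, (n : ℝ≥0) ≤ a.height → cut a h ∈ persistent X := by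
  rw [isMittagLeffler_iff_ancestor]
  constructor
  · intro hX h
    obtain ⟨j, hj⟩ := exists_nat_ge h
    obtain ⟨i, hji, hi⟩ := hX j
    -- Round `h` up to level `j + 1`. The vertex there on the path to `a` comes from level `i`,
    -- hence from every level `k`, and a preimage at level `k` is a point above it.
    refine ⟨i, fun a ha => persistent_of_le (cut_le_cut a (s := ((j + 1 : ℕ) : ℝ≥0)) ?_) ?_⟩
    · exact hj.trans (by exact_mod_cast Nat.le_succ j)
    intro k
    rw [cut_natCast ((Nat.cast_le.2 hji).trans ha), ← ancestor_vertexAt hji ha]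
    obtain ⟨y, hy⟩ := hi (max k (j + 1)) (le_max_right _ _) ⟨a.vertexAt ha, rfl⟩
    refine ⟨ofVertex y, ?_, Nat.cast_le.2 (le_max_left _ _)⟩
    have h1 : ((j + 1 : ℕ) : ℝ≥0) ≤ (ofVertex y).height := Nat.cast_le.2 (le_max_right _ _)
    have h2 := ofVertex_vertexAt_le h1
    rwa [vertexAt_ofVertex, hy] at h2
  · intro hX j
    obtain ⟨n, hn⟩ := hX ((j + 1 : ℕ) : ℝ≥0)
    -- The bound `n` makes the ancestor at level `j + 1` persistent; `j + 1` makes it exist.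
    refine ⟨max n (j + 1), le_max_right _ _, fun k hjk => ?_⟩
    rintro _ ⟨x, rfl⟩
    have ha : ((j + 1 : ℕ) : ℝ≥0) ≤ (ofVertex x).height := Nat.cast_le.2 (le_max_right _ _)
    obtain ⟨b, hb, hk⟩ := hn (ofVertex x) (Nat.cast_le.2 (le_max_left _ _)) k
    refine ⟨b.vertexAt hk, ?_⟩
    rw [ancestor_vertexAt, ← vertexAt_ofVertex x ha,
      vertexAt_of_le (cut_le (ofVertex x) ((j + 1 : ℕ) : ℝ≥0)) (cut_height ha).ge,
      vertexAt_of_le hb (cut_height ha).ge]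

/-! ### Rays and the greatest geodesically complete subtree -/

lemma ray_height {S : Set (Tree X)} {g : Ici (0 : ℝ) → S} (hg : Isometry g)
    (h0 : (g ⟨0, self_mem_Ici⟩ : Tree X) = root X) (s : Ici (0 : ℝ)) :
    ((g s : Tree X).height : ℝ) = s := by
  have h : dist (g ⟨0, self_mem_Ici⟩ : Tree X) (g s) = |(0 : ℝ) - s| := hg.dist_eq _ _
  rw [h0, dist_root] at h
  rw [h, zero_sub, abs_neg, abs_of_nonneg s.2]

lemma ray_mono {S : Set (Tree X)} {g : Ici (0 : ℝ) → S} (hg : Isometry g)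
    (h0 : (g ⟨0, self_mem_Ici⟩ : Tree X) = root X) {s t : Ici (0 : ℝ)} (hst : s ≤ t) :
    (g s : Tree X) ≤ g t := by
  have h : dist (g s : Tree X) (g t) = |(s : ℝ) - t| := hg.dist_eq _ _
  have hst' : (s : ℝ) ≤ t := hst
  rw [le_iff_dist, h, ray_height hg h0, ray_height hg h0, abs_sub_comm, abs_of_nonneg]
  linarith

/-- Each point of a geodesically complete subtree lies on a ray of the subtree. -/
lemma exists_ray {S : Set (Tree X)} (hS : IsGeodesicallyCompleteSubtree (root X) S) {a : Tree X}
    (ha : a ∈ S) (h : 0 < a.height) : ∃ g : Ici (0 : ℝ) → S, Isometry g ∧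
      (g ⟨0, self_mem_Ici⟩ : Tree X) = root X ∧ (g ⟨a.height, a.height.2⟩ : Tree X) = a := by
  obtain ⟨hv, hT, hG⟩ := hS
  have h' : (0 : ℝ) < a.height := by exact_mod_cast h
  have hle : ∀ s : Icc (0 : ℝ) a.height, (s : ℝ).toNNReal ≤ a.height := fun s =>
    Real.toNNReal_le_iff_le_coe.2 s.2.2
  -- The geodesic from the root to `a`, to be extended by completeness; it stays in `S` because `S`
  -- is a subtree containing the root.
  let f : Icc (0 : ℝ) a.height → S := fun s =>
    ⟨cut a (s : ℝ).toNNReal, lower_of_isRealTree hv hT (cut_le _ _) ha⟩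
  have hf0 : (f ⟨0, le_rfl, h'.le⟩ : Tree X) = root X := by
    refine eq_root ?_
    simp [f, cut]
  obtain ⟨g, hg, hgf⟩ := hG a.height h' f
    (Isometry.of_dist_eq fun s t => by
      change dist (cut a _) (cut a _) = _
      rw [dist_cut_cut (hle s) (hle t), Real.coe_toNNReal _ s.2.1, Real.coe_toNNReal _ t.2.1]
      rfl) (Subtype.ext hf0)
  refine ⟨g, hg, ?_, ?_⟩
  · rw [← hf0, ← hgf]
  · have := hgf ⟨a.height, h'.le, le_rfl⟩
    refine (congrArg Subtype.val this).trans ?_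
    exact cut_of_height_le (by simp)

/-- A ray through a point passes above it to every height. The root is separate: it belongs to `T_∞`
even when the tree is bounded and nothing is persistent. -/
lemma maximalGCSubtree_subset :
    maximalGCSubtree (root X) ⊆ insert (root X) (persistent X) := by
  rintro a ⟨S, hS, ha⟩
  rcases eq_or_ne a.height 0 with h | h
  · exact Or.inl (eq_root h)
  refine Or.inr fun n => ?_
  obtain ⟨g, hg, h0, hga⟩ := exists_ray hS ha (pos_iff_ne_zero.2 h)
  let s : Ici (0 : ℝ) := ⟨max a.height n, le_max_of_le_left a.height.2⟩
  refine ⟨g s, ?_, ?_⟩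
  · nth_rewrite 1 [← hga]
    exact ray_mono hg h0 (le_max_left (a.height : ℝ) n)
  · rw [← NNReal.coe_le_coe, ray_height hg h0]
    exact le_max_right (a.height : ℝ) n

lemma lower_insert_persistent (a b : Tree X) (hab : a ≤ b)
    (hb : b ∈ insert (root X) (persistent X)) : a ∈ insert (root X) (persistent X) := by
  rcases hb with rfl | hb
  · exact Or.inl (eq_root (le_antisymm hab.1 zero_le))
  · exact Or.inr (persistent_of_le hab hb)

/-- Some point far above `a` exists by persistence; by Mittag-Leffler its path already passes height
`a.height + 1` at a persistent point. An arbitrary point one unit above `a` could be a dead end. -/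
lemma exists_succ_persistent (hX : X.IsMittagLeffler) {a : Tree X} (ha : a ∈ persistent X) :
    ∃ b ∈ persistent X, a ≤ b ∧ b.height = a.height + 1 := by
  obtain ⟨n, hn⟩ := isMittagLeffler_iff.1 hX (a.height + 1)
  obtain ⟨m, hm⟩ := exists_nat_ge (a.height + 1)
  obtain ⟨b, hb, hk⟩ := ha (max n m)
  have h1 : a.height + 1 ≤ b.height := hm.trans ((Nat.cast_le.2 (le_max_right n m)).trans hk)
  exact ⟨cut b (a.height + 1), hn b ((Nat.cast_le.2 (le_max_left n m)).trans hk),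
    le_cut hb (by simp), cut_height h1⟩

/-- If the sequence is Mittag-Leffler, each persistent point lies on a ray of such points. -/
lemma exists_ray_persistent (hX : X.IsMittagLeffler) {a : Tree X} (ha : a ∈ persistent X) :
    ∃ g : Ici (0 : ℝ) → Tree X, Isometry g ∧ (∀ s, g s ∈ persistent X) ∧
      ∀ s : Ici (0 : ℝ), (s : ℝ) ≤ a.height → g s = cut a (s : ℝ).toNNReal := by
  choose! F hF hle hh using fun b : Tree X => exists_succ_persistent hX (a := b)
  -- An increasing chain of persistent points starting at `a`, with the height of `y k` at least
  -- `k`; the ray is its union.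
  let y : ℕ → Tree X := fun k => F^[k] a
  have hy : ∀ k, y k ∈ persistent X := by
    intro k
    induction k with
    | zero => exact ha
    | succ k ih => simp only [y, Function.iterate_succ_apply']; exact hF _ ih
  have hstep : ∀ k, y k ≤ y (k + 1) := fun k => by
    have := hle _ (hy k)
    simpa only [y, Function.iterate_succ_apply'] using this
  have hmono : ∀ k l, k ≤ l → y k ≤ y l := fun k l h => by
    induction l, h using Nat.le_induction with
    | base => exact le_refl' _
    | succ l _ ih => exact le_trans' ih (hstep l)
  have hyh : ∀ k : ℕ, ((k : ℕ) : ℝ≥0) ≤ (y k).height := fun k => by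
    induction k with
    | zero => simp
    | succ k ih =>
      have : (y (k + 1)).height = (y k).height + 1 := by
        simp only [y, Function.iterate_succ_apply']; exact hh _ (hy k)
      rw [this]; push_cast; gcongr
  -- The point of the ray at height `s` does not depend on the member of the chain it is cut from,
  -- so any two parameters can be compared on one path.
  have hcut : ∀ (s : ℝ≥0) (k l : ℕ), s ≤ (y k).height → s ≤ (y l).height →
      cut (y k) s = cut (y l) s := fun s k l hk hl => by
    rcases le_total k l with h | h
    · exact cut_eq_cut_of_le (hmono k l h) hk
    · exact (cut_eq_cut_of_le (hmono l k h) hl).symm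
  have hceil : ∀ s : ℝ≥0, s ≤ (y ⌈s⌉₊).height := fun s => (Nat.le_ceil s).trans (hyh _)
  refine ⟨fun s => cut (y ⌈(s : ℝ).toNNReal⌉₊) (s : ℝ).toNNReal, Isometry.of_dist_eq fun s t => ?_,
    fun s => persistent_of_le (cut_le _ _) (hy _), fun s hs => ?_⟩
  · obtain ⟨k, hks, hkt⟩ : ∃ k, (s : ℝ).toNNReal ≤ (y k).height ∧
        (t : ℝ).toNNReal ≤ (y k).height :=
      ⟨max ⌈(s : ℝ).toNNReal⌉₊ ⌈(t : ℝ).toNNReal⌉₊,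
        (hceil _).trans (hmono _ _ (le_max_left _ _)).1,
        (hceil _).trans (hmono _ _ (le_max_right _ _)).1⟩
    rw [hcut _ _ k (hceil _) hks, hcut _ _ k (hceil _) hkt, dist_cut_cut hks hkt,
      Real.coe_toNNReal _ s.2, Real.coe_toNNReal _ t.2]
    rfl
  · exact hcut _ _ 0 (hceil _) (Real.toNNReal_le_iff_le_coe.2 hs)

/-- The right-hand side is itself geodesically complete, hence a member of the union: a segment from
the root is the path to its endpoint, and a ray through that endpoint extends it. -/
theorem maximalGCSubtree_eq (hX : X.IsMittagLeffler) :
    maximalGCSubtree (root X) = insert (root X) (persistent X) := by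
  refine maximalGCSubtree_subset.antisymm (subset_sUnion_of_mem
    ⟨Or.inl rfl, isRealTree_of_lower lower_insert_persistent, fun t ht f hf hf0 => ?_⟩)
  have hf0' : (f ⟨0, le_rfl, ht.le⟩ : Tree X) = root X := congrArg Subtype.val hf0
  have hd : ∀ s s', dist (f s : Tree X) (f s') = |(s : ℝ) - s'| := fun s s' => hf.dist_eq s s'
  have hheight : ∀ s, ((f s : Tree X).height : ℝ) = s := by
    intro s
    have h := hd ⟨0, le_rfl, ht.le⟩ s
    rw [hf0', dist_root] at h
    rw [h, zero_sub, abs_neg, abs_of_nonneg s.2.1]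
  have hle : ∀ s, (f s : Tree X) ≤ f ⟨t, ht.le, le_rfl⟩ := by
    intro s
    rw [le_iff_dist, hd, hheight, hheight, abs_sub_comm, abs_of_nonneg]
    exact sub_nonneg.2 s.2.2
  -- The endpoint has height `t > 0`, so it is not the root.
  have hp : (f ⟨t, ht.le, le_rfl⟩ : Tree X) ∈ persistent X := by
    refine (f ⟨t, ht.le, le_rfl⟩).2.resolve_left fun h => ht.ne ?_
    have := hheight ⟨t, ht.le, le_rfl⟩
    rw [h] at this
    simpa using this
  obtain ⟨g, hg, hgp, hgf⟩ := exists_ray_persistent hX hp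
  refine ⟨fun s => ⟨g s, Or.inr (hgp s)⟩, Isometry.of_dist_eq fun s s' => hg.dist_eq s s',
    fun s => Subtype.ext ?_⟩
  change g ⟨s, s.2.1⟩ = f s
  rw [hgf _ (by rw [hheight]; exact s.2.2), ← cut_height_of_le (hle s)]
  congr 1
  exact NNReal.coe_injective (by rw [hheight, Real.coe_toNNReal _ s.2.1])

/-- Persistence is constant on half-open edges. If `k` is the height of the lower endpoint of the
edge of `a`, a point `c` at distance less than `a.height - k` branches off from `a` above height
`k`, so a point `d` of that edge lies below `c` and is persistent with it. -/
lemma isClosed_insert_persistent : IsClosed (insert (root X) (persistent X)) := by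
  refine isClosed_of_closure_subset fun a ha => ?_
  rcases eq_or_ne a.height 0 with h | h
  · exact Or.inl (eq_root h)
  obtain ⟨k, hk⟩ := Nat.exists_eq_succ_of_ne_zero (Nat.ceil_pos.2 (pos_iff_ne_zero.2 h)).ne'
  have hka : (k : ℝ≥0) < a.height := Nat.lt_ceil.1 (by omega)
  have hka' : (k : ℝ) < a.height := by exact_mod_cast hka
  obtain ⟨c, hc, hd⟩ := Metric.mem_closure_iff.1 ha _ (sub_pos.2 hka')
  obtain ⟨d, da, dc, hdm, -⟩ := exists_inf a c
  have h1 : (meet a c : ℝ) ≤ c.height := mod_cast meet_le_right a c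
  have hkd : (k : ℝ≥0) < d.height := by
    rw [hdm, ← NNReal.coe_lt_coe, NNReal.coe_natCast]
    rw [dist_def] at hd
    linarith
  have hdp : d ∈ persistent X := by
    refine (lower_insert_persistent d c dc hc).resolve_left ?_
    rintro rfl
    exact absurd hkd (by simp)
  refine Or.inr fun n => ?_
  obtain ⟨m, hm⟩ := exists_nat_ge a.height
  obtain ⟨b, hb, hn⟩ := hdp (max n m)
  refine ⟨b, le_of_ceil_height_eq da hb ?_ (hm.trans ((Nat.cast_le.2 (le_max_right n m)).trans hn)),
    (Nat.cast_le.2 (le_max_left n m)).trans hn⟩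
  rw [hk]
  exact Nat.succ_le_of_lt (Nat.lt_ceil.2 hkd)

/-! ### The retraction onto a closed rooted subtree -/

lemma dist_cut_right_le (a : Tree X) (r s : ℝ≥0) : dist (cut a r) (cut a s) ≤ dist r s := by
  have h (t : ℝ≥0) : cut a t = cut a (min t a.height) :=
    eq_of_le_of_height (le_of_height_le (cut_le _ _) (cut_le _ _) (by simp [cut])) (by simp [cut])
  rw [h r, h s, dist_cut_cut (min_le_right _ _) (min_le_right _ _), NNReal.dist_eq,
    NNReal.coe_min, NNReal.coe_min]
  exact abs_min_sub_min_le_max _ _ _ _ |>.trans (by simp)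

/-- If `r` is at most the height of the branching point, both cuts coincide; otherwise cutting only
shortens the two branches. -/
lemma dist_cut_left_le (a b : Tree X) (r : ℝ≥0) : dist (cut a r) (cut b r) ≤ dist a b := by
  obtain ⟨c, ca, cb, hc, -⟩ := exists_inf a b
  have key (d : Tree X) (h : c ≤ d) : cut c r ≤ cut d r :=
    le_cut (le_trans' (cut_le _ _) h) (min_le_left _ _)
  have h := height_le_meet (key a ca) (key b cb)
  have h' : min (r : ℝ) c.height ≤ meet (cut a r) (cut b r) := by exact_mod_cast h
  have ha : (c.height : ℝ) ≤ a.height := by exact_mod_cast ca.1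
  have hb : (c.height : ℝ) ≤ b.height := by exact_mod_cast cb.1
  rw [dist_def, dist_def, ← hc]
  have e (d : Tree X) : ((cut d r).height : ℝ) = min (r : ℝ) d.height := by simp [cut]
  rw [e, e]
  rcases le_total (r : ℝ) c.height with h1 | h1
  · rw [min_eq_left h1] at h'
    have := min_le_left (r : ℝ) a.height
    have := min_le_left (r : ℝ) b.height
    linarith
  · rw [min_eq_right h1] at h'
    have := min_le_right (r : ℝ) a.height
    have := min_le_right (r : ℝ) b.height
    linarith

lemma continuous_cut : Continuous fun p : Tree X × ℝ≥0 => cut p.1 p.2 :=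
  (LipschitzWith.uncurry (f := cut (X := X)) (Kα := 1) (Kβ := 1)
    (fun r => LipschitzWith.of_dist_le_mul fun a b => by simpa using dist_cut_left_le a b r)
    (fun a => LipschitzWith.of_dist_le_mul fun r s => by
      simpa using dist_cut_right_le a r s)).continuous

lemma continuous_height_nnreal : Continuous (height : Tree X → ℝ≥0) :=
  NNReal.isEmbedding_coe.continuous_iff.2 continuous_height

/-- The height at which the path from the root to `a` leaves `S`. -/
noncomputable def exitHeight (S : Set (Tree X)) (a : Tree X) : ℝ≥0 :=
  sSup (height '' {c | c ≤ a ∧ c ∈ S})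

lemma bddAbove_exitHeight (S : Set (Tree X)) (a : Tree X) :
    BddAbove (height '' {c | c ≤ a ∧ c ∈ S}) :=
  ⟨a.height, by rintro _ ⟨c, hc, rfl⟩; exact hc.1.1⟩

lemma height_le_exitHeight {S : Set (Tree X)} {a c : Tree X} (h : c ≤ a) (hc : c ∈ S) :
    c.height ≤ exitHeight S a :=
  le_csSup (bddAbove_exitHeight S a) ⟨c, ⟨h, hc⟩, rfl⟩

lemma exitHeight_le (S : Set (Tree X)) (a : Tree X) : exitHeight S a ≤ a.height :=
  csSup_le' (by rintro _ ⟨c, hc, rfl⟩; exact hc.1.1)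

lemma exitHeight_of_mem {S : Set (Tree X)} {a : Tree X} (h : a ∈ S) :
    exitHeight S a = a.height :=
  (exitHeight_le S a).antisymm (height_le_exitHeight (le_refl' a) h)

/-- The supremum is attained because `S` is closed: points of `S` on the path whose heights approach
it converge to this cut. -/
lemma cut_exitHeight_mem {S : Set (Tree X)} (hv : root X ∈ S) (hcl : IsClosed S) (a : Tree X) :
    cut a (exitHeight S a) ∈ S := by
  have hne : (height '' {c | c ≤ a ∧ c ∈ S}).Nonempty := ⟨_, root X, ⟨root_le a, hv⟩, rfl⟩
  refine hcl.closure_subset (Metric.mem_closure_iff.2 fun ε hε => ?_)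
  obtain ⟨_, ⟨c, hc, rfl⟩, hlt⟩ := Metric.mem_closure_iff.1
    (csSup_mem_closure hne (bddAbove_exitHeight S a)) ε hε
  refine ⟨c, hc.2, lt_of_le_of_lt ?_ hlt⟩
  have h := dist_cut_right_le a (exitHeight S a) c.height
  rwa [cut_height_of_le hc.1] at h

/-- The exit height is 1-Lipschitz. The part of the path to `a` that lies in `S`, up to the
branching point with `b`, is also part of the path to `b`; beyond that point the excess is at most
the distance from it to `a`. -/
lemma continuous_exitHeight {S : Set (Tree X)} (hv : root X ∈ S) (hcl : IsClosed S)
    (hS : ∀ a b, a ≤ b → b ∈ S → a ∈ S) : Continuous (exitHeight S) := by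
  refine NNReal.isEmbedding_coe.continuous_iff.2
    (LipschitzWith.of_le_add fun a b => ?_).continuous
  obtain ⟨c, ca, cb, hc, -⟩ := exists_inf a b
  have ha : (exitHeight S a : ℝ) ≤ a.height := exitHeight_le S a
  have hb : (meet a b : ℝ) ≤ b.height := meet_le_right a b
  have h : min (exitHeight S a) (meet a b) ≤ exitHeight S b := by
    have h1 : min (exitHeight S a) (meet a b) ≤ a.height :=
      (min_le_right _ _).trans (meet_le_left a b)
    rw [← cut_height h1]
    refine height_le_exitHeight (le_trans' (le_of_height_le (cut_le _ _) ca ?_) cb)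
      (hS _ _ (cut_le_cut a (min_le_left _ _)) (cut_exitHeight_mem hv hcl a))
    rw [cut_height h1, hc]
    exact min_le_right _ _
  have h' : min (exitHeight S a : ℝ) (meet a b) ≤ exitHeight S b := by exact_mod_cast h
  have h0 : (0 : ℝ) ≤ dist a b := dist_nonneg
  rw [dist_def] at h0 ⊢
  simp only [Function.comp_apply]
  rcases min_le_iff.1 h' with h | h <;> linarith

/-- The homotopy that contracts the paths to the points outside `S` to the last point in `S`. -/
noncomputable def contraction (S : Set (Tree X)) (p : I × Tree X) : Tree X :=
  cut p.2 (max (exitHeight S p.2) (unitInterval.toNNReal (unitInterval.symm p.1) * p.2.height))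

/-- No time of the homotopy goes below the exit height, so a lower bound for the exit height gives
properness of the whole homotopy. -/
lemma contraction_height (S : Set (Tree X)) (p : I × Tree X) :
    exitHeight S p.2 ≤ (contraction S p).height :=
  le_min (le_max_left _ _) (exitHeight_le S p.2)

lemma continuous_contraction {S : Set (Tree X)} (h : Continuous (exitHeight S)) :
    Continuous (contraction S) := by
  have := continuous_height_nnreal (X := X)
  refine continuous_cut.comp (continuous_snd.prodMk ?_)
  fun_prop

/-- A closed subtree that contains the point at height `h` of each path from the root that is long
enough, for every `h`, is a rooted metrically proper deformation retract. -/
theorem isRootedMetricallyProperDeformationRetract {S : Set (Tree X)} (hv : root X ∈ S)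
    (hcl : IsClosed S) (hS : ∀ a b, a ≤ b → b ∈ S → a ∈ S)
    (hp : ∀ h : ℝ≥0, ∃ n : ℕ, ∀ a : Tree X, (n : ℝ≥0) ≤ a.height → cut a h ∈ S) :
    IsRootedMetricallyProperDeformationRetract (root X) S hv := by
  have hcont := continuous_exitHeight hv hcl hS
  have hexit : ∀ M : ℝ, ∃ N : ℝ, 0 < N ∧
      ∀ a : Tree X, (exitHeight S a : ℝ) < M → (a.height : ℝ) < N := by
    intro M
    obtain ⟨n, hn⟩ := hp M.toNNReal
    -- Above `n` the cut at height `M` lies in `S`; above `M` this cut really has height `M`; the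
    -- `1` keeps the radius positive.
    refine ⟨max n (max M 1), lt_max_of_lt_right (lt_max_of_lt_right one_pos), fun a ha => ?_⟩
    by_contra! hcon
    have h1 : (n : ℝ≥0) ≤ a.height := by exact_mod_cast (le_max_left _ _).trans hcon
    have h2 : M.toNNReal ≤ a.height :=
      Real.toNNReal_le_iff_le_coe.2 (((le_max_left _ _).trans (le_max_right _ _)).trans hcon)
    have h3 := height_le_exitHeight (cut_le a M.toNNReal) (hn a h1)
    rw [cut_height h2] at h3
    exact absurd ha (not_lt.2 (Real.toNNReal_le_iff_le_coe.1 h3))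
  let r : C(Tree X, S) :=
    ⟨fun a => ⟨cut a (exitHeight S a), cut_exitHeight_mem hv hcl a⟩,
      (continuous_cut.comp (continuous_id.prodMk hcont)).subtype_mk _⟩
  let i : C(S, Tree X) := ⟨Subtype.val, continuous_subtype_val⟩
  have hrS : ∀ x : S, r x = x := fun x => Subtype.ext <| by
    change cut (x : Tree X) (exitHeight S (x : Tree X)) = x
    rw [exitHeight_of_mem x.2, cut_of_height_le le_rfl]
  let H : (ContinuousMap.id (Tree X)).HomotopyRel (i.comp r) S :=
    { toFun := contraction S
      continuous_toFun := continuous_contraction hcont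
      map_zero_left := fun a => cut_of_height_le (by simp)
      map_one_left := fun a => by simp [contraction, i, r]
      prop' := fun t a ha =>
        cut_of_height_le ((exitHeight_of_mem ha).ge.trans (le_max_left _ _)) }
  have hH : IsRootedMetricallyProperHomotopy (root X) (root X) H.toHomotopy := by
    refine ⟨fun t => H.eq_fst t hv, fun M hM => ?_⟩
    obtain ⟨N, hN, h⟩ := hexit M
    refine ⟨N, hN, fun p hpM => ⟨trivial, ?_⟩⟩
    rw [Metric.mem_ball', dist_root]
    refine h _ (lt_of_le_of_lt (NNReal.coe_le_coe.2 (contraction_height S p)) ?_)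
    rw [← dist_root, dist_comm]
    exact hpM
  have hbdd : ∀ A : Set (Tree X), (∃ M : ℝ, ∀ a ∈ A, (a.height : ℝ) < M) →
      Bornology.IsBounded A := by
    rintro A ⟨M, hM⟩
    refine Metric.isBounded_ball.subset (t := Metric.ball (root X) M) fun a ha => ?_
    rw [Metric.mem_ball', dist_root]
    exact hM a ha
  refine ⟨r, i, fun _ => rfl, ⟨⟨hrS ⟨root X, hv⟩, fun A hA => ?_⟩, ⟨rfl, fun A hA => ?_⟩,
    ⟨H.toHomotopy.symm, fun t => hH.1 _, fun M hM => ?_⟩, ?_⟩, H, hH⟩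
  · obtain ⟨M, hM⟩ := hA.subset_ball ⟨root X, hv⟩
    obtain ⟨N, hN, h⟩ := hexit M
    refine hbdd _ ⟨N, fun a ha => h a ?_⟩
    have h1 : dist (root X) (cut a (exitHeight S a)) < M := Metric.mem_ball'.1 (hM ha)
    rwa [dist_root, cut_height (exitHeight_le S a)] at h1
  · exact isometry_subtype_coe.antilipschitz.isBounded_preimage hA
  · obtain ⟨N, hN, h⟩ := hH.2 M hM
    exact ⟨N, hN, fun p hpM => ⟨trivial, (h (a := (unitInterval.symm p.1, p.2)) hpM).2⟩⟩
  · have hri : r.comp i = ContinuousMap.id S := ContinuousMap.ext hrS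
    rw [hri]
    refine ⟨ContinuousMap.Homotopy.refl _, fun t => rfl, fun M hM => ⟨M, hM, fun p hpM =>
      ⟨trivial, hpM⟩⟩⟩

/-! ### The converse -/

/-- A path outside of the ball of radius `h` around the root stays in one branch at height `h`. -/
lemma cut_le_of_joinedIn {a b : Tree X} {h : ℝ≥0} (hj : JoinedIn {z : Tree X | h ≤ z.height} a b) :
    cut a h ≤ b := by
  obtain ⟨γ, hγ⟩ := hj
  obtain ⟨c, ca, cb, hc, -⟩ := exists_inf a b
  -- Every path from `a` to `b` passes through their branching point, which therefore has height at
  -- least `h`.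
  obtain ⟨s, rfl⟩ := mem_range_path γ ca hc.ge
  exact le_trans' (le_of_height_le (cut_le _ _) ca ((min_le_left _ _).trans (hγ s))) cb

/-- Properness read contrapositively: far points have far images. -/
lemma exists_dist_bound {T T' : Type*} [MetricSpace T] [MetricSpace T'] {v : T} {w : T'}
    {f : C(T, T')} (hf : IsRootedMetricallyProper v w f) (M : ℝ) :
    ∃ R : ℝ, 0 < R ∧ ∀ a, R ≤ dist v a → M ≤ dist w (f a) := by
  obtain ⟨R, hR, h⟩ := (hf.2 _ (Metric.isBounded_ball (x := w) (r := M))).subset_ball_lt 0 v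
  refine ⟨R, hR, fun a ha => ?_⟩
  by_contra! hcon
  exact absurd (Metric.mem_ball'.1 (h (Metric.mem_ball'.2 hcon))) (not_lt.2 ha)

/-- If the tree is rooted metrically properly homotopy dominated by a geodesically complete subtree,
then the inverse sequence is Mittag-Leffler. -/
theorem isMittagLeffler_of_homotopy {S : Set (Tree X)}
    (hS : IsGeodesicallyCompleteSubtree (root X) S) {f : C(Tree X, S)} {g : C(S, Tree X)}
    (hf : IsRootedMetricallyProper (root X) ⟨root X, hS.1⟩ f)
    (hg : IsRootedMetricallyProper (⟨root X, hS.1⟩ : S) (root X) g)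
    (H : (g.comp f).Homotopy (ContinuousMap.id (Tree X)))
    (hH : IsRootedMetricallyProperHomotopy (root X) (root X) H) : X.IsMittagLeffler := by
  have hdist : ∀ y : S, dist (⟨root X, hS.1⟩ : S) y = (y : Tree X).height := fun y =>
    dist_root (y : Tree X)
  refine isMittagLeffler_iff.2 fun h => ?_
  -- The radius has to be positive and `h` may be `0`, hence `h + 1`.
  obtain ⟨N, hN, hHN⟩ := hH.2 (h + 1) (by positivity)
  obtain ⟨R, hR, hgR⟩ := exists_dist_bound hg h
  obtain ⟨R', -, hfR⟩ := exists_dist_bound hf R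
  -- Beyond `N` the homotopy stays at height at least `h`; beyond `R'` the image `f a` is at height
  -- at least `R`, where `g` takes values at height at least `h`. As `R > 0`, `f a` is not the root
  -- and lies on a ray.
  obtain ⟨n, hn⟩ := exists_nat_ge (max N R')
  refine ⟨n, fun a ha k => ?_⟩
  have ha' : max N R' ≤ a.height := hn.trans (by exact_mod_cast ha)
  have hfa : R ≤ (f a : Tree X).height := by
    rw [← hdist]
    exact hfR a (by rw [dist_root]; exact (le_max_right _ _).trans ha')
  obtain ⟨γ, hγ, h0, hγa⟩ := exists_ray hS (f a).2 (by exact_mod_cast hR.trans_le hfa)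
  obtain ⟨K, hK, hgK⟩ := exists_dist_bound hg k
  let t₀ : ℝ := (f a : Tree X).height
  have ht₀ : 0 ≤ t₀ := (f a : Tree X).height.2
  have hj₁ : JoinedIn {z : Tree X | h ≤ z.height} a (g (f a)) := by
    refine JoinedIn.symm ⟨⟨⟨fun t => H (t, a), by fun_prop⟩, by simp, by simp⟩, fun t => ?_⟩
    change h ≤ (H (t, a)).height
    by_contra! hlt
    have hmem : (t, a) ∈ H ⁻¹' Metric.ball (root X) (h + 1) := by
      rw [mem_preimage, Metric.mem_ball', dist_root]
      have : ((H (t, a)).height : ℝ) < h := by exact_mod_cast hlt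
      linarith
    have := Metric.mem_ball'.1 (hHN hmem).2
    rw [dist_root] at this
    exact absurd ((le_max_left _ _).trans ha') (not_le.2 this)
  -- The piece of the ray from `f a`, at parameter `t₀`, to parameter `t₀ + K ≥ K`, where `g` has
  -- reached height `k`.
  let s : I → Ici (0 : ℝ) := fun t => ⟨t₀ + t * K, add_nonneg ht₀ (mul_nonneg t.2.1 hK.le)⟩
  have hs : Continuous s := by
    refine Continuous.subtype_mk ?_ _
    fun_prop
  have hj₂ : JoinedIn {z : Tree X | h ≤ z.height} (g (f a)) (g (γ (s 1))) := by
    refine ⟨⟨⟨fun t => g (γ (s t)), g.continuous.comp (hγ.continuous.comp hs)⟩, ?_, rfl⟩,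
      fun t => ?_⟩
    · have h1 : s 0 = ⟨t₀, ht₀⟩ := Subtype.ext (by simp [s])
      change g (γ (s 0)) = _
      rw [h1]
      exact congrArg g (Subtype.ext hγa)
    · change h ≤ (g (γ (s t))).height
      have h1 : R ≤ dist (⟨root X, hS.1⟩ : S) (γ (s t)) := by
        rw [hdist, ray_height hγ h0]
        have := mul_nonneg t.2.1 hK.le
        change R ≤ t₀ + t * K
        linarith
      have h2 := hgR _ h1
      rw [dist_root] at h2
      exact_mod_cast h2
  refine ⟨g (γ (s 1)), cut_le_of_joinedIn (hj₁.trans hj₂), ?_⟩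
  have h1 : K ≤ dist (⟨root X, hS.1⟩ : S) (γ (s 1)) := by
    rw [hdist, ray_height hγ h0]
    change K ≤ t₀ + (1 : ℝ) * K
    linarith
  have h2 := hgK _ h1
  rw [dist_root] at h2
  exact_mod_cast h2

end Tree

end InverseSequence

/-! ### The proposition -/

theorem proposition7p10 (X : ℕᵒᵖ ⥤ Type*) :
    (X.IsMittagLeffler ↔
      ∃ (f : C(InverseSequence.Tree X, maximalGCSubtree (InverseSequence.Tree.root X)))
        (g : C(maximalGCSubtree (InverseSequence.Tree.root X), InverseSequence.Tree X)),
        IsRootedMetricallyProperHomotopyEquiv (InverseSequence.Tree.root X)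
          ⟨InverseSequence.Tree.root X, InverseSequence.Tree.root_mem_maximalGCSubtree X⟩ f g) ∧
    (X.IsMittagLeffler →
      IsRootedMetricallyProperDeformationRetract (InverseSequence.Tree.root X)
        (maximalGCSubtree (InverseSequence.Tree.root X))
        (InverseSequence.Tree.root_mem_maximalGCSubtree X)) := by
  have key (hX : X.IsMittagLeffler) :
      IsRootedMetricallyProperDeformationRetract (InverseSequence.Tree.root X)
        (maximalGCSubtree (InverseSequence.Tree.root X))
        (InverseSequence.Tree.root_mem_maximalGCSubtree X) := by
    have hE := InverseSequence.Tree.maximalGCSubtree_eq hX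
    refine InverseSequence.Tree.isRootedMetricallyProperDeformationRetract _
      (hE ▸ InverseSequence.Tree.isClosed_insert_persistent)
      (hE ▸ InverseSequence.Tree.lower_insert_persistent) fun h => ?_
    obtain ⟨n, hn⟩ := InverseSequence.Tree.isMittagLeffler_iff.1 hX h
    exact ⟨n, fun a ha => hE ▸ Or.inr (hn a ha)⟩
  refine ⟨⟨fun hX => ?_, ?_⟩, key⟩
  · obtain ⟨r, i, -, h, -⟩ := key hX
    exact ⟨r, i, h⟩
  · rintro ⟨f, g, hf, hg, ⟨H, hH⟩, -⟩
    exact InverseSequence.Tree.isMittagLeffler_of_homotopy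
      (InverseSequence.Tree.isGreatest_maximalGCSubtree X).1 hf hg H hH
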